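/- Let $K$ be an infinite field. Let $A$ be a finite-dimensional associative unital $K$-algebra with $K$-basis $u_1,\dots,u_n$, let $K(\xi)=K(\xi_1,\dots,\xi_n)$ be the rational function field, and let $$m_{a(\xi)}(\lambda)=\lambda^m+c_1(\xi)\lambda^{m-1}+\dots+c_m(\xi)$$ be the minimal polynomial over $K(\xi)$ of the general element $a(\xi)=\sum_i\xi_i u_i\in A\otimes_K K(\xi)$. Its coefficients lie in $K[\xi_1,\dots,\xi_n]$. Its degree $m$ is called the (reduced) degree of $A$ over $K$, and the reduced norm $\bar n:A\to K$ is the polynomial function $\bar n(b)=(-1)^m c_m(b_1,\dots,b_n)$ for $b=\sum_i b_iu_i$ with $b_i\in K$. A character on $A$ is a function $\chi:A\to K$ that is polynomial in the coordinates with respect to a $K$-basis of $A$ and satisfies $\chi(1)=1$ and $\chi(ab)=\chi(a)\chi(b)$ for all $a,b\in A$. Theorem 6.2.1. Let $D$ be a finite-dimensional division algebra over $K$, let $C$ be its center, and suppose that $D$ has reduced degree $d$ over $C$ and that $C$ has reduced degree $c$ over $K$. Then for every integer $k\ge 1$: (a) the matrix algebra $M_k(D)$ has reduced degree $dkc$ over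 $K$; (b) for every character $\chi:M_k(D)\to K$ there is an integer $t\ge 0$ such that $\chi(a)=\bar n(a)^t$ for all $a\in M_k(D)$, where $\bar n$ is the reduced norm of $M_k(D)$ over $K$. -/

import Mathlib

open scoped TensorProduct

noncomputable section

namespace ReducedNorm

variable (K : Type*) [Field K] (A : Type*) [Ring A] [Algebra K A] [FiniteDimensional K A]

/-- The index set `{1, …, n}`, `n = dim_K A`, of the coordinates on `A`. -/
abbrev Idx : Type := Fin (Module.finrank K A)

/-- A vector space basis `u₁, …, uₙ` of `A` over `K`. -/
def basis : Module.Basis (Idx K A) K A := Module.finBasis K A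

/-- The polynomial ring `K[ξ] = K[ξ₁, …, ξₙ]`. -/
abbrev PolyRing : Type _ := MvPolynomial (Idx K A) K

/-- The rational function field `K(ξ) = K(ξ₁, …, ξₙ)`. -/
abbrev RatField : Type _ := FractionRing (PolyRing K A)

/-- The general element `a(ξ) = ∑ ξᵢ uᵢ` of `K(ξ) ⊗_K A`. -/
def generalElement : RatField K A ⊗[K] A :=
  ∑ i, (algebraMap (PolyRing K A) (RatField K A) (MvPolynomial.X i)) ⊗ₜ[K] (basis K A i)

/-- The minimal polynomial of the general element over `K(ξ)`. -/
def generalMinpoly : Polynomial (RatField K A) :=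
  minpoly (RatField K A) (generalElement K A)

/-- The (reduced) degree of `A` over `K`: the degree of the minimal polynomial of the general
element. -/
def reducedDegree : ℕ := (generalMinpoly K A).natDegree

/-- The minimal polynomial of the general element has its coefficients in `K[ξ]`. -/
theorem exists_map_eq_generalMinpoly :
    ∃ P : Polynomial (PolyRing K A),
      P.map (algebraMap (PolyRing K A) (RatField K A)) = generalMinpoly K A := by
  let y : PolyRing K A ⊗[K] A := ∑ i, (MvPolynomial.X i : PolyRing K A) ⊗ₜ[K] (basis K A i)
  let f : PolyRing K A ⊗[K] A →ₐ[PolyRing K A] RatField K A ⊗[K] A :=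
    Algebra.TensorProduct.map (Algebra.ofId (PolyRing K A) (RatField K A)) (AlgHom.id K A)
  have hf : f y = generalElement K A := by
    simp [f, y, generalElement, map_sum, Algebra.ofId_apply]
  obtain ⟨p, hp, hpy⟩ : IsIntegral (PolyRing K A) y := IsIntegral.of_finite _ y
  have hdvd : generalMinpoly K A ∣ p.map (algebraMap (PolyRing K A) (RatField K A)) := by
    apply minpoly.dvd
    rw [Polynomial.aeval_map_algebraMap, ← hf, Polynomial.aeval_algHom_apply,
      Polynomial.aeval_def, hpy, map_zero]
  have hmonic : (generalMinpoly K A).Monic := minpoly.monic (IsIntegral.of_finite _ _)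
  obtain ⟨P, hP⟩ := IsIntegrallyClosed.eq_map_mul_C_of_dvd (RatField K A) hp hdvd
  exact ⟨P, by simpa [hmonic.leadingCoeff] using hP⟩

/-- The minimal polynomial `λᵐ + c₁(ξ) λᵐ⁻¹ + ⋯ + cₘ(ξ)` of the general element, with its
coefficients regarded as elements of `K[ξ]`. -/
def generalCharpoly : Polynomial (PolyRing K A) :=
  (exists_map_eq_generalMinpoly K A).choose

theorem map_generalCharpoly :
    (generalCharpoly K A).map (algebraMap (PolyRing K A) (RatField K A)) = generalMinpoly K A :=
  (exists_map_eq_generalMinpoly K A).choose_spec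

variable {A}

/-- The coordinates of `b ∈ A` in the basis `u₁, …, uₙ`. -/
def coords (b : A) : Idx K A → K := fun i => (basis K A).repr b i

/-- The reduced characteristic polynomial of `b = ∑ bᵢ uᵢ`, obtained from the minimal polynomial
of the general element by specializing `ξᵢ` to `bᵢ`. -/
def reducedCharpoly (b : A) : Polynomial K :=
  (generalCharpoly K A).map (MvPolynomial.eval (coords K b))

/-- The reduced norm `(-1)ᵐ cₘ(b)` of `b`, where `m` is the degree of `A` over `K`. -/
def reducedNorm (b : A) : K :=
  (-1) ^ reducedDegree K A * (reducedCharpoly K b).coeff 0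

variable {K}

/-- A function `A → K` is polynomial if it is given by a polynomial in the coordinates. -/
def IsPolynomialFunction (χ : A → K) : Prop :=
  ∃ p : PolyRing K A, ∀ a : A, χ a = MvPolynomial.eval (coords K a) p

/-- A character on `A`: a polynomial function `A → K` that is multiplicative and takes `1`
to `1`. -/
structure IsCharacter (χ : A → K) : Prop where
  polynomial : IsPolynomialFunction χ
  map_one : χ 1 = 1
  map_mul : ∀ a b : A, χ (a * b) = χ a * χ b

end ReducedNorm

end

/-!
A regular element is one whose minimal polynomial has degree `reducedDegree K A`. Regular elements
are Zariski-dense, so identities between polynomial functions need only be checked on them, where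
the reduced characteristic polynomial is the minimal polynomial.

A character `χ` applied to `b * adj b = n(b)` shows that `χ` divides a power of the reduced norm
`n`; hence it is a power of `n` as soon as `n` is an irreducible polynomial. On `M_k(D)` this can be
checked on a plane: for the companion matrix `γ(s)` of `X ^ k - s w`, where `w` is a nonzero regular
element of `D`, the norm of `t - γ(s)` is the irreducible minimal polynomial `μ` of `w`, homogenized
in `t ^ k` and `s`. As a polynomial in `s` it is the reverse of `μ` with its roots scaled by
`t ^ k`, which is irreducible, and its degree in `t` equals the degree of `n`.

For the degree of `M_k(D)`, the bound from above is transitivity along `K ⊆ C`: a polynomial over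
`C` divides one over `K` of at most `reducedDegree K C` times its degree, while the degree of
`M_k(D)` over its center `C` is computed after base change to an algebraic closure. The bound from
below comes from elements of large degree: for `z ∈ C` regular over `K` and `w ∈ D` regular and
separable over `C`, a primitive element of a subfield of `C(w)` has degree at least
`reducedDegree K C * reducedDegree C D`, and the companion matrix multiplies this by `k`.
-/

noncomputable section

namespace ReducedNorm

open Polynomial

section Minpoly

variable {K B : Type*} [Field K] [Ring B] [Algebra K B]

theorem eq_minpoly_of_natDegree_le {x : B} {p : K[X]} (hp : p.Monic) (hx : aeval x p = 0)
    (hdeg : p.natDegree ≤ (minpoly K x).natDegree) : p = minpoly K x :=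
  eq_of_monic_of_dvd_of_natDegree_le (minpoly.monic ⟨p, hp, hx⟩) hp (minpoly.dvd K x hx) hdeg

theorem natDegree_minpoly_le_of_aeval_eq_zero {x : B} {p : K[X]} (hp : p ≠ 0)
    (hx : aeval x p = 0) : (minpoly K x).natDegree ≤ p.natDegree :=
  natDegree_le_of_dvd (minpoly.dvd K x hx) hp

theorem le_natDegree_of_linearIndependent_pow {x : B} {n : ℕ}
    (h : LinearIndependent K fun i : Fin n => x ^ (i : ℕ)) {p : K[X]} (hp : p ≠ 0)
    (hx : aeval x p = 0) : n ≤ p.natDegree := by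
  by_contra! hlt
  rw [aeval_eq_sum_range' hlt, Finset.sum_range] at hx
  exact leadingCoeff_ne_zero.2 hp (Fintype.linearIndependent_iff.1 h _ hx ⟨_, hlt⟩)

theorem minpoly_smul {x : B} (hx : IsIntegral K x) {s : K} (hs : s ≠ 0) :
    minpoly K (s • x) = (minpoly K x).scaleRoots s := by
  have hroot (r : K) (y : B) : aeval (r • y) ((minpoly K y).scaleRoots r) = 0 := by
    rw [Algebra.smul_def]
    exact scaleRoots_aeval_eq_zero (minpoly.aeval K y)
  refine (eq_minpoly_of_natDegree_le ((monic_scaleRoots_iff s).2 (minpoly.monic hx))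
    (hroot s x) ?_).symm
  rw [natDegree_scaleRoots, ← natDegree_scaleRoots (minpoly K (s • x)) s⁻¹]
  refine natDegree_minpoly_le_of_aeval_eq_zero
    (scaleRoots_ne_zero (minpoly.ne_zero (hx.smul s)) s⁻¹) ?_
  simpa only [inv_smul_smul₀ hs] using hroot s⁻¹ (s • x)

theorem minpoly_sub_algebraMap {x : B} (hx : IsIntegral K x) (t : K) :
    minpoly K (x - algebraMap K B t) = (minpoly K x).comp (X + C t) := by
  have hmonic : ((minpoly K x).comp (X + C t)).Monic := (minpoly.monic hx).comp_X_add_C t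
  have hroot : aeval (x - algebraMap K B t) ((minpoly K x).comp (X + C t)) = 0 := by
    simp [aeval_comp]
  refine (eq_minpoly_of_natDegree_le hmonic hroot ?_).symm
  have hle := natDegree_minpoly_le_of_aeval_eq_zero (x := x)
    ((minpoly.monic ⟨_, hmonic, hroot⟩).comp_X_sub_C t).ne_zero (by simp [aeval_comp])
  simpa only [natDegree_comp, natDegree_X_sub_C, natDegree_X_add_C, mul_one] using hle

end Minpoly

section Evaluation

variable {σ R : Type*} [CommSemiring R]

theorem eval_mvPolynomial_aeval (f : σ → R[X]) (p : MvPolynomial σ R) (t : R) :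
    (MvPolynomial.aeval f p).eval t = MvPolynomial.eval (fun i => (f i).eval t) p :=
  MvPolynomial.comp_aeval_apply _ (aeval t) p

theorem mvPolynomial_eval_aeval {τ : Type*} (f : σ → MvPolynomial τ R) (p : MvPolynomial σ R)
    (y : τ → R) : MvPolynomial.eval y (MvPolynomial.aeval f p) =
      MvPolynomial.eval (fun i => MvPolynomial.eval y (f i)) p :=
  MvPolynomial.comp_aeval_apply _ (MvPolynomial.aeval y) p

theorem eval_aeval_C_mul_X (s : R) (p : MvPolynomial σ R) (y : σ → R) :
    MvPolynomial.eval y (MvPolynomial.aeval (fun i => MvPolynomial.C s * MvPolynomial.X i) p) =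
      MvPolynomial.eval (s • y) p := by
  simp only [mvPolynomial_eval_aeval, map_mul, MvPolynomial.eval_C, MvPolynomial.eval_X]
  rfl

theorem coeff_aeval_C_mul_X (s : R) (p : MvPolynomial σ R) (d : σ →₀ ℕ) :
    (MvPolynomial.aeval (fun i => MvPolynomial.C s * MvPolynomial.X i) p).coeff d =
      s ^ d.degree * p.coeff d := by
  classical
  induction p using MvPolynomial.induction_on' with
  | monomial u a =>
    have hmonomial : MvPolynomial.aeval (fun i => MvPolynomial.C s * MvPolynomial.X i)
        (MvPolynomial.monomial u a) =
          MvPolynomial.C (s ^ u.degree) * MvPolynomial.monomial u a := by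
      rw [MvPolynomial.aeval_monomial, MvPolynomial.monomial_eq, Finsupp.prod, Finsupp.prod]
      simp only [mul_pow, Finset.prod_mul_distrib, Finset.prod_pow_eq_pow_sum,
        Finsupp.degree_apply, map_pow, MvPolynomial.algebraMap_eq]
      ring
    rw [hmonomial, MvPolynomial.coeff_C_mul, MvPolynomial.coeff_monomial]
    split_ifs with h
    · rw [h]
    · simp only [mul_zero]
  | add p q hp hq => simp only [map_add, MvPolynomial.coeff_add, hp, hq, mul_add]

end Evaluation

section InfiniteField

variable {K : Type*} [Field K] [Infinite K]

theorem eq_of_eval_eq_of_ne_zero {p q : K[X]} (h : ∀ s ≠ 0, p.eval s = q.eval s) : p = q :=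
  eq_of_infinite_eval_eq p q ((Set.finite_singleton (0 : K)).infinite_compl.mono h)

theorem eq_of_eval_C_eval_eq {p q : K[X][X]}
    (h : ∀ s ≠ 0, ∀ t, (p.eval (C s)).eval t = (q.eval (C s)).eval t) : p = q :=
  eq_of_infinite_eval_eq p q <|
    ((Set.finite_singleton (0 : K)).infinite_compl.image C_injective.injOn).mono <| by
      rintro _ ⟨s, hs, rfl⟩
      exact Polynomial.funext (h s hs)

theorem exists_eval_eq_pow_of_eval_mul {p : K[X]} (hone : p.eval 1 = 1)
    (hmul : ∀ s t, p.eval (s * t) = p.eval s * p.eval t) : ∃ n : ℕ, ∀ t, p.eval t = t ^ n := by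
  have hp : p ≠ 0 := by
    rintro rfl
    simp at hone
  refine ⟨p.natDegree, fun t => mul_left_cancel₀ (leadingCoeff_ne_zero.2 hp) ?_⟩
  have hcomp : p.comp (C t * X) = C (p.eval t) * p := Polynomial.funext fun s => by
    simp only [eval_comp, eval_mul, eval_C, eval_X, hmul]
  rw [mul_comm, leadingCoeff, ← coeff_C_mul, ← hcomp, comp_C_mul_X_coeff]

theorem isHomogeneous_of_aeval_C_mul_X {σ : Type*} {p : MvPolynomial σ K} {n : ℕ}
    (h : ∀ s : K, s ≠ 0 → MvPolynomial.aeval (fun i => MvPolynomial.C s * MvPolynomial.X i) p =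
      MvPolynomial.C (s ^ n) * p) : p.IsHomogeneous n := by
  intro d hd
  have hpow : (X ^ d.degree : K[X]) = X ^ n := eq_of_eval_eq_of_ne_zero fun s hs => by
    have hcoeff := coeff_aeval_C_mul_X s p d
    rw [h s hs, MvPolynomial.coeff_C_mul] at hcoeff
    simpa only [eval_pow, eval_X] using (mul_right_cancel₀ hd hcoeff).symm
  rw [Pi.one_def, ← Finsupp.degree_eq_weight_one]
  simpa only [natDegree_X_pow] using congrArg natDegree hpow

end InfiniteField

section Reverse

variable {K : Type*}

theorem eval_scaleRoots_reverse [CommSemiring K] {p : K[X]} (hp : p.coeff 0 ≠ 0) (s t : K) :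
    (p.reverse.scaleRoots t).eval s = (p.scaleRoots s).eval t := by
  have hdeg : p.reverse.natDegree = p.natDegree := by
    rw [reverse_natDegree, natTrailingDegree_eq_zero.2 (Or.inr hp), Nat.sub_zero]
  rw [eval_eq_sum_range, eval_eq_sum_range, natDegree_scaleRoots, natDegree_scaleRoots, hdeg,
    ← Finset.sum_flip]
  refine Finset.sum_congr rfl fun i hi => ?_
  have hi' : i ≤ p.natDegree := Nat.lt_succ_iff.1 (Finset.mem_range.1 hi)
  rw [coeff_scaleRoots, coeff_scaleRoots, hdeg, coeff_reverse, revAt_le (Nat.sub_le _ _),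
    Nat.sub_sub_self hi']
  ring

theorem irreducible_reverse [CommRing K] [IsDomain K] {p : K[X]} (hp : Irreducible p)
    (h0 : p.coeff 0 ≠ 0) : Irreducible p.reverse := by
  let mirrorEquiv : K[X] ≃* K[X] :=
    { toFun := mirror
      invFun := mirror
      left_inv := mirror_mirror
      right_inv := mirror_mirror
      map_mul' := fun p q => mirror_mul_of_domain p q }
  have hmirror : mirrorEquiv p = p.reverse := by
    change p.mirror = _
    rw [mirror, natTrailingDegree_eq_zero.2 (Or.inr h0), pow_zero, mul_one]
  rw [← hmirror]
  exact (MulEquiv.irreducible_iff mirrorEquiv).2 hp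

end Reverse

section Specialization

variable (K : Type*) [Field K] (A : Type*) [Ring A] [Algebra K A]

/-- Extension of scalars from `K[ξ] ⊗ A` to `K(ξ) ⊗ A`. -/
def toRatField : PolyRing K A ⊗[K] A →ₐ[PolyRing K A] RatField K A ⊗[K] A :=
  Algebra.TensorProduct.map (Algebra.ofId (PolyRing K A) (RatField K A)) (AlgHom.id K A)

theorem toRatField_injective : Function.Injective (toRatField K A) := by
  have hflat := Module.Flat.rTensor_preserves_injective_linearMap (M := A)
    (IsScalarTower.toAlgHom K (PolyRing K A) (RatField K A)).toLinearMap
    (IsFractionRing.injective (PolyRing K A) (RatField K A))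
  have heq (x : PolyRing K A ⊗[K] A) : toRatField K A x = LinearMap.rTensor A
      (IsScalarTower.toAlgHom K (PolyRing K A) (RatField K A)).toLinearMap x := by
    induction x with
    | zero => rw [map_zero, map_zero]
    | tmul x y => rfl
    | add x y hx hy => rw [map_add, map_add, hx, hy]
  exact fun x y hxy => hflat (by rw [← heq, ← heq, hxy])

variable {K A}
variable {R : Type*} [CommRing R] [Algebra K R]
variable {B : Type*} [Ring B] [Algebra K B] [Algebra R B] [IsScalarTower K R B]

/-- Specialization of the indeterminates `ξᵢ` to elements `yᵢ` of a commutative algebra `R`, along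
an algebra homomorphism `φ` from `A` to an `R`-algebra. -/
def specialize (φ : A →ₐ[K] B) (y : Idx K A → R) : PolyRing K A ⊗[K] A →ₐ[K] B :=
  Algebra.TensorProduct.lift ((IsScalarTower.toAlgHom K R B).comp (MvPolynomial.aeval y)) φ
    (fun _ _ => Algebra.commutes _ _)

theorem specialize_tmul (φ : A →ₐ[K] B) (y : Idx K A → R) (p : PolyRing K A) (a : A) :
    specialize φ y (p ⊗ₜ a) = MvPolynomial.aeval y p • φ a := by
  rw [Algebra.smul_def]
  exact Algebra.TensorProduct.lift_tmul _ _ _ _ _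

theorem specialize_algebraMap (φ : A →ₐ[K] B) (y : Idx K A → R) (p : PolyRing K A) :
    specialize φ y (algebraMap _ _ p) = algebraMap R B (MvPolynomial.aeval y p) := by
  rw [Algebra.TensorProduct.algebraMap_apply, specialize_tmul, map_one, Algebra.smul_def, mul_one]
  rfl

variable [FiniteDimensional K A]

theorem specialize_eq_sum (φ : A →ₐ[K] B) (y : Idx K A → R) (z : PolyRing K A ⊗[K] A) :
    specialize φ y z = ∑ i, MvPolynomial.aeval y
      ((Algebra.TensorProduct.basis (PolyRing K A) (basis K A)).repr z i) • φ (basis K A i) := by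
  conv_lhs => rw [← (Algebra.TensorProduct.basis (PolyRing K A) (basis K A)).sum_repr z]
  rw [map_sum]
  refine Finset.sum_congr rfl fun i _ => ?_
  rw [Algebra.TensorProduct.basis_apply, TensorProduct.smul_tmul', smul_eq_mul, mul_one,
    specialize_tmul]

variable (K A)

/-- The general element `∑ ξᵢ uᵢ`, with its coefficients in `K[ξ]` rather than `K(ξ)`. -/
def genericElement : PolyRing K A ⊗[K] A :=
  ∑ i, (MvPolynomial.X i : PolyRing K A) ⊗ₜ[K] basis K A i

theorem toRatField_genericElement : toRatField K A (genericElement K A) = generalElement K A := by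
  simp only [toRatField, genericElement, generalElement, map_sum, Algebra.TensorProduct.map_tmul,
    Algebra.ofId_apply, AlgHom.id_apply]

theorem monic_generalCharpoly : (generalCharpoly K A).Monic := by
  refine monic_of_injective (IsFractionRing.injective _ (RatField K A)) ?_
  rw [map_generalCharpoly]
  exact minpoly.monic (IsIntegral.of_finite _ _)

theorem natDegree_generalCharpoly : (generalCharpoly K A).natDegree = reducedDegree K A := by
  rw [reducedDegree, ← map_generalCharpoly, (monic_generalCharpoly K A).natDegree_map]

theorem aeval_genericElement_generalCharpoly :
    aeval (genericElement K A) (generalCharpoly K A) = 0 := by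
  apply toRatField_injective
  rw [← aeval_algHom_apply, toRatField_genericElement, map_zero,
    ← aeval_map_algebraMap (RatField K A), map_generalCharpoly]
  exact minpoly.aeval _ _

variable {K A}

theorem monic_map_generalCharpoly {S : Type*} [CommRing S] (f : PolyRing K A →+* S) :
    ((generalCharpoly K A).map f).Monic :=
  (monic_generalCharpoly K A).map f

theorem natDegree_map_generalCharpoly {S : Type*} [CommRing S] [Nontrivial S]
    (f : PolyRing K A →+* S) : ((generalCharpoly K A).map f).natDegree = reducedDegree K A := by
  rw [(monic_generalCharpoly K A).natDegree_map, natDegree_generalCharpoly]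

theorem specialize_genericElement (φ : A →ₐ[K] B) (y : Idx K A → R) :
    specialize φ y (genericElement K A) = ∑ i, y i • φ (basis K A i) := by
  simp only [genericElement, map_sum, specialize_tmul, MvPolynomial.aeval_X]

theorem aeval_map_generalCharpoly (φ : A →ₐ[K] B) (y : Idx K A → R) :
    aeval (∑ i, y i • φ (basis K A i))
      ((generalCharpoly K A).map (MvPolynomial.aeval (R := K) y).toRingHom) = 0 := by
  rw [← specialize_genericElement φ, aeval_def, eval₂_map,
    ← map_zero (specialize φ y), ← aeval_genericElement_generalCharpoly, aeval_def,
    ← AlgHom.coe_toRingHom, hom_eval₂]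
  congr 1
  exact RingHom.ext fun p => (specialize_algebraMap φ y p).symm

theorem coords_eq_equivFun (b : A) : coords K b = (basis K A).equivFun b := rfl

theorem sum_coords_smul (b : A) : ∑ i, coords K b i • basis K A i = b :=
  (basis K A).sum_repr b

theorem coords_sum (y : Idx K A → K) : coords K (∑ i, y i • basis K A i) = y :=
  funext fun i => congrFun ((basis K A).repr_sum_self y) i

theorem aeval_reducedCharpoly (b : A) : aeval b (reducedCharpoly K b) = 0 := by
  have h := aeval_map_generalCharpoly (AlgHom.id K A) (coords K b)
  simp only [AlgHom.id_apply, sum_coords_smul] at h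
  exact h

theorem monic_reducedCharpoly (b : A) : (reducedCharpoly K b).Monic :=
  (monic_generalCharpoly K A).map _

theorem natDegree_reducedCharpoly (b : A) :
    (reducedCharpoly K b).natDegree = reducedDegree K A := by
  rw [reducedCharpoly, natDegree_map_generalCharpoly]

theorem natDegree_minpoly_le_reducedDegree (b : A) :
    (minpoly K b).natDegree ≤ reducedDegree K A :=
  natDegree_reducedCharpoly (K := K) b ▸ natDegree_minpoly_le_of_aeval_eq_zero
    (monic_reducedCharpoly b).ne_zero (aeval_reducedCharpoly b)

variable (K)

/-- Evaluation at `b ∈ A` of elements of `K[ξ] ⊗ A`, regarded as polynomial functions from `A` to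
`A`. -/
def evalAt (b : A) : PolyRing K A ⊗[K] A →ₐ[K] A :=
  specialize (AlgHom.id K A) (coords K b)

theorem evalAt_genericElement (b : A) : evalAt K b (genericElement K A) = b := by
  rw [evalAt, specialize_genericElement]
  exact sum_coords_smul b

theorem coords_evalAt (b : A) (z : PolyRing K A ⊗[K] A) (i : Idx K A) :
    coords K (evalAt K b z) i = MvPolynomial.eval (coords K b)
      ((Algebra.TensorProduct.basis (PolyRing K A) (basis K A)).repr z i) := by
  rw [evalAt, specialize_eq_sum]
  exact congrFun (coords_sum _) i

end Specialization

section Regular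

/-- Unlike the independence itself, such a left inverse up to a scalar can be specialized. -/
theorem exists_mul_eq_smul_one {R m n : Type*} [CommRing R] [IsDomain R] [Fintype m] [Finite n]
    [DecidableEq n] {M : Matrix m n R} (h : LinearIndependent R M.col) :
    ∃ δ : R, δ ≠ 0 ∧ ∃ B : Matrix n m R, B * M = δ • 1 := by
  have := Fintype.ofFinite n
  classical
  let F := FractionRing R
  let N : Matrix m n F := M.map (algebraMap R F)
  have hN : LinearIndependent F N.col := (LinearIndependent.iff_fractionRing R F).1 <|
    h.map' ((Algebra.linearMap R F).compLeft m) <| LinearMap.ker_eq_bot.2 <|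
      (IsFractionRing.injective R F).comp_left
  obtain ⟨g, hg⟩ := LinearMap.exists_leftInverse_of_injective (Matrix.toLin' N)
    (LinearMap.ker_eq_bot.2 (Matrix.mulVec_injective_iff.2 hN))
  have hgN : LinearMap.toMatrix' g * N = 1 := by
    rw [← LinearMap.toMatrix'_toLin' N, ← LinearMap.toMatrix'_comp, hg, LinearMap.toMatrix'_id]
  obtain ⟨δ, hδ⟩ := IsLocalization.exist_integer_multiples_of_finite (nonZeroDivisors R)
    (fun ij : n × m => LinearMap.toMatrix' g ij.1 ij.2)
  choose B hB using hδ
  refine ⟨δ, nonZeroDivisors.coe_ne_zero δ, Matrix.of fun i j => B (i, j), ?_⟩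
  refine Matrix.map_injective (IsFractionRing.injective R F) ?_
  have hBg : (Matrix.of fun i j => B (i, j)).map (algebraMap R F) =
      (δ : R) • LinearMap.toMatrix' g := Matrix.ext fun i j => hB (i, j)
  beta_reduce
  rw [Matrix.map_mul, hBg, Matrix.smul_mul, hgN, Matrix.map_smul' _ _ _ (map_mul _),
    Matrix.map_one _ (map_zero _) (map_one _), algebraMap_smul]

theorem linearIndependent_col_of_mul_eq_smul_one {F m n : Type*} [Field F] [Fintype m] [Finite n]
    [DecidableEq n] {M : Matrix m n F} {B : Matrix n m F} {d : F} (hd : d ≠ 0)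
    (h : B * M = d • 1) : LinearIndependent F M.col := by
  have := Fintype.ofFinite n
  rw [← Matrix.mulVec_injective_iff]
  refine Function.LeftInverse.injective (g := (d⁻¹ • B).mulVec) fun v => ?_
  rw [Matrix.mulVec_mulVec, Matrix.smul_mul, h, inv_smul_smul₀ hd, Matrix.one_mulVec]

variable (K : Type*) [Field K] {A : Type*} [Ring A] [Algebra K A] [FiniteDimensional K A]

/-- An element of `A` is regular if its minimal polynomial has the largest possible degree, namely
the reduced degree of `A`. -/
def IsRegular (b : A) : Prop :=
  (minpoly K b).natDegree = reducedDegree K A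

variable (A)

theorem linearIndependent_genericElement_pow :
    LinearIndependent (PolyRing K A)
      fun j : Fin (reducedDegree K A) => genericElement K A ^ (j : ℕ) := by
  have h : LinearIndependent (RatField K A)
      fun j : Fin (reducedDegree K A) => generalElement K A ^ (j : ℕ) := linearIndependent_pow _
  have hpow : (toRatField K A).toLinearMap ∘
      (fun j : Fin (reducedDegree K A) => genericElement K A ^ (j : ℕ)) =
        fun j : Fin (reducedDegree K A) => generalElement K A ^ (j : ℕ) := funext fun j => by
    rw [Function.comp_apply, AlgHom.toLinearMap_apply, map_pow, toRatField_genericElement]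
  exact LinearIndependent.of_comp (toRatField K A).toLinearMap
    (hpow ▸ (LinearIndependent.iff_fractionRing (PolyRing K A) (RatField K A)).2 h)

theorem exists_isRegular_of_eval_ne_zero :
    ∃ Δ : PolyRing K A, Δ ≠ 0 ∧ ∀ b : A, MvPolynomial.eval (coords K b) Δ ≠ 0 → IsRegular K b := by
  let e := (Algebra.TensorProduct.basis (PolyRing K A) (basis K A)).equivFun
  let M : Matrix (Idx K A) (Fin (reducedDegree K A)) (PolyRing K A) :=
    Matrix.of fun i j => e (genericElement K A ^ (j : ℕ)) i
  have hM : LinearIndependent (PolyRing K A) M.col :=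
    (linearIndependent_genericElement_pow K A).map' e.toLinearMap e.ker
  obtain ⟨Δ, hΔ, B, hB⟩ := exists_mul_eq_smul_one hM
  refine ⟨Δ, hΔ, fun b hb => le_antisymm (natDegree_minpoly_le_reducedDegree b) ?_⟩
  let ev := MvPolynomial.eval (coords K b)
  have hcol : (M.map ev).col = (basis K A).equivFun.toLinearMap ∘
      fun j : Fin (reducedDegree K A) => b ^ (j : ℕ) := funext fun j => funext fun i => by
    have hpow : evalAt K b (genericElement K A ^ (j : ℕ)) = b ^ (j : ℕ) := by
      rw [map_pow, evalAt_genericElement]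
    rw [Function.comp_apply, LinearEquiv.coe_coe, ← coords_eq_equivFun, ← hpow, coords_evalAt]
    rfl
  have hspec : B.map ev * M.map ev = ev Δ • 1 := by
    rw [← Matrix.map_mul, hB, Matrix.map_smul' _ _ _ (map_mul ev),
      Matrix.map_one _ (map_zero ev) (map_one ev)]
  have hli : LinearIndependent K fun j : Fin (reducedDegree K A) => b ^ (j : ℕ) :=
    LinearIndependent.of_comp (basis K A).equivFun.toLinearMap
      (hcol ▸ linearIndependent_col_of_mul_eq_smul_one hb hspec)
  exact le_natDegree_of_linearIndependent_pow hli
    (minpoly.ne_zero (IsIntegral.of_finite K b)) (minpoly.aeval K b)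

variable {K A}

theorem IsRegular.reducedCharpoly_eq_minpoly {b : A} (hb : IsRegular K b) :
    reducedCharpoly K b = minpoly K b :=
  eq_minpoly_of_natDegree_le (monic_reducedCharpoly b) (aeval_reducedCharpoly b)
    (natDegree_reducedCharpoly (K := K) b ▸ hb.ge)

theorem eq_of_eval_coords_eq_of_isRegular [Infinite K] {p q : PolyRing K A}
    (h : ∀ b : A, IsRegular K b →
      MvPolynomial.eval (coords K b) p = MvPolynomial.eval (coords K b) q) : p = q := by
  obtain ⟨Δ, hΔ, hreg⟩ := exists_isRegular_of_eval_ne_zero K A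
  refine mul_left_cancel₀ hΔ (MvPolynomial.funext fun y => ?_)
  rw [map_mul, map_mul, mul_eq_mul_left_iff, or_iff_not_imp_right]
  intro hy
  rw [← coords_sum y] at hy ⊢
  exact h _ (hreg _ hy)

variable (K A) in
theorem exists_isRegular [Infinite K] : ∃ b : A, IsRegular K b := by
  by_contra! h
  exact zero_ne_one (eq_of_eval_coords_eq_of_isRegular (p := (0 : PolyRing K A)) (q := 1)
    fun b hb => absurd hb (h b))

end Regular

section Norm

variable (K : Type*) [Field K] (A : Type*) [Ring A] [Algebra K A] [FiniteDimensional K A]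

/-- The reduced norm as a polynomial in the coordinates. -/
def normPoly : PolyRing K A :=
  (-1) ^ reducedDegree K A * (generalCharpoly K A).coeff 0

variable {K A}

theorem reducedNorm_eq_eval (b : A) :
    reducedNorm K b = MvPolynomial.eval (coords K b) (normPoly K A) := by
  simp only [reducedNorm, normPoly, reducedCharpoly, coeff_map, map_mul, map_pow, map_neg, map_one]

theorem IsRegular.smul {b : A} (hb : IsRegular K b) {s : K} (hs : s ≠ 0) :
    IsRegular K (s • b) := by
  rw [IsRegular, minpoly_smul (IsIntegral.of_finite K b) hs, natDegree_scaleRoots, hb]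

theorem IsRegular.sub_algebraMap {b : A} (hb : IsRegular K b) (t : K) :
    IsRegular K (b - algebraMap K A t) := by
  rw [IsRegular, minpoly_sub_algebraMap (IsIntegral.of_finite K b), natDegree_comp,
    natDegree_X_add_C, mul_one, hb]

theorem IsRegular.reducedNorm_algebraMap_sub {b : A} (hb : IsRegular K b) (t : K) :
    reducedNorm K (algebraMap K A t - b) = (minpoly K b).eval t := by
  have hreg : IsRegular K (b - algebraMap K A t) := hb.sub_algebraMap t
  have hneg : reducedCharpoly K (algebraMap K A t - b) =
      (minpoly K (b - algebraMap K A t)).scaleRoots (-1) := by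
    rw [← minpoly_smul (IsIntegral.of_finite K _) (neg_ne_zero.2 one_ne_zero),
      ← (hreg.smul (neg_ne_zero.2 one_ne_zero)).reducedCharpoly_eq_minpoly, neg_one_smul, neg_sub]
  rw [reducedNorm, hneg, coeff_scaleRoots, hreg, Nat.sub_zero, mul_left_comm, ← mul_pow,
    neg_one_mul, neg_neg, one_pow, mul_one, minpoly_sub_algebraMap (IsIntegral.of_finite K b),
    coeff_zero_eq_eval_zero, eval_comp, eval_add, eval_X, eval_C, zero_add]

variable [Infinite K]

variable (K A)

theorem isHomogeneous_coeff_generalCharpoly (i : ℕ) :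
    ((generalCharpoly K A).coeff i).IsHomogeneous (reducedDegree K A - i) := by
  refine isHomogeneous_of_aeval_C_mul_X fun s hs => eq_of_eval_coords_eq_of_isRegular fun b hb => ?_
  have hscale : reducedCharpoly K (s • b) = (reducedCharpoly K b).scaleRoots s := by
    rw [hb.reducedCharpoly_eq_minpoly, (hb.smul hs).reducedCharpoly_eq_minpoly,
      minpoly_smul (IsIntegral.of_finite K b) hs]
  have hcoeff := congrArg (coeff · i) hscale
  beta_reduce at hcoeff
  rw [coeff_scaleRoots, natDegree_reducedCharpoly, reducedCharpoly, reducedCharpoly, coeff_map,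
    coeff_map, coords_eq_equivFun, map_smul, ← coords_eq_equivFun] at hcoeff
  rw [eval_aeval_C_mul_X, hcoeff, map_mul, MvPolynomial.eval_C, mul_comm]

theorem isHomogeneous_normPoly : (normPoly K A).IsHomogeneous (reducedDegree K A) := by
  have hC : (-1 : PolyRing K A) ^ reducedDegree K A =
      MvPolynomial.C ((-1) ^ reducedDegree K A) := by
    rw [map_pow, map_neg, map_one]
  rw [normPoly, hC]
  exact (isHomogeneous_coeff_generalCharpoly K A 0).C_mul _

theorem reducedCharpoly_zero : reducedCharpoly K (0 : A) = X ^ reducedDegree K A := by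
  ext i
  rcases lt_trichotomy i (reducedDegree K A) with hi | rfl | hi
  · have hzero : MvPolynomial.coeff 0 ((generalCharpoly K A).coeff i) = 0 :=
      (isHomogeneous_coeff_generalCharpoly K A i).coeff_eq_zero
        (by rw [map_zero]; exact (Nat.sub_pos_of_lt hi).ne)
    rw [reducedCharpoly, coeff_map, coords_eq_equivFun, map_zero, coeff_X_pow, if_neg hi.ne,
      MvPolynomial.eval_zero, MvPolynomial.constantCoeff_eq, hzero]
  · rw [coeff_X_pow_self, ← natDegree_reducedCharpoly (0 : A),
      (monic_reducedCharpoly 0).coeff_natDegree]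
  · rw [coeff_eq_zero_of_natDegree_lt (by rwa [natDegree_reducedCharpoly]),
      coeff_eq_zero_of_natDegree_lt (by rwa [natDegree_X_pow])]

variable {A}

theorem reducedNorm_algebraMap_sub (b : A) (t : K) :
    reducedNorm K (algebraMap K A t - b) = (reducedCharpoly K b).eval t := by
  let q : PolyRing K A := MvPolynomial.aeval
    (fun i => MvPolynomial.C (coords K (algebraMap K A t) i) - MvPolynomial.X i) (normPoly K A)
  have hnorm (b : A) : MvPolynomial.eval (coords K b) q = reducedNorm K (algebraMap K A t - b) := by
    rw [mvPolynomial_eval_aeval, reducedNorm_eq_eval]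
    simp only [coords_eq_equivFun, map_sub, MvPolynomial.eval_C, MvPolynomial.eval_X]
    rfl
  have hcharpoly (b : A) : MvPolynomial.eval (coords K b)
      ((generalCharpoly K A).eval (MvPolynomial.C t)) = (reducedCharpoly K b).eval t := by
    rw [← eval_map_apply, MvPolynomial.eval_C, reducedCharpoly]
  have hgeneric : q = (generalCharpoly K A).eval (MvPolynomial.C t) :=
    eq_of_eval_coords_eq_of_isRegular fun b hb => by
      rw [hnorm, hcharpoly, hb.reducedNorm_algebraMap_sub, hb.reducedCharpoly_eq_minpoly]
  rw [← hnorm, ← hcharpoly, hgeneric]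

variable (A)

theorem reducedNorm_one : reducedNorm K (1 : A) = 1 := by
  simpa [reducedCharpoly_zero] using reducedNorm_algebraMap_sub K (0 : A) 1

end Norm

section Character

variable {K : Type*} [Field K] {A : Type*} [Ring A] [Algebra K A] [FiniteDimensional K A]

theorem mul_aeval_divX {R B : Type*} [CommRing R] [Ring B] [Algebra R B] (x : B) (p : R[X]) :
    x * aeval x p.divX = aeval x p - algebraMap R B (p.coeff 0) := by
  nth_rw 2 [← X_mul_divX_add p]
  rw [map_add, map_mul, aeval_X, aeval_C, add_sub_cancel_right]

theorem exists_algebraMap_eq_pow_of_isCharacter [Infinite K] {χ : A → K} (hχ : IsCharacter χ) :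
    ∃ n : ℕ, ∀ s : K, χ (algebraMap K A s) = s ^ n := by
  obtain ⟨p, hp⟩ := hχ.polynomial
  let q : K[X] := MvPolynomial.aeval (fun i => C (coords K (1 : A) i) * X) p
  have hq (s : K) : q.eval s = χ (algebraMap K A s) := by
    rw [hp, Algebra.algebraMap_eq_smul_one, eval_mvPolynomial_aeval]
    simp only [eval_mul, eval_C, eval_X, coords_eq_equivFun, map_smul, Pi.smul_def, smul_eq_mul,
      mul_comm]
  simp only [← hq]
  refine exists_eval_eq_pow_of_eval_mul ?_ fun s t => ?_
  · rw [hq, map_one, hχ.map_one]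
  · rw [hq, hq, hq, map_mul, hχ.map_mul]

variable (K A) in
/-- The adjoint of the general element `x`: the element `y` of `K[ξ][x]` for which `x * y` is the
reduced norm of `x`. -/
def genericAdjoint : PolyRing K A ⊗[K] A :=
  (-1 : PolyRing K A) ^ (reducedDegree K A + 1) •
    aeval (genericElement K A) (generalCharpoly K A).divX

variable (K A) in
theorem genericElement_mul_genericAdjoint :
    genericElement K A * genericAdjoint K A = algebraMap _ _ (normPoly K A) := by
  have hsign : (-1 : PolyRing K A) ^ (reducedDegree K A + 1) * -(generalCharpoly K A).coeff 0 =
      normPoly K A := by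
    rw [normPoly, pow_succ]
    ring
  rw [genericAdjoint, mul_smul_comm, mul_aeval_divX, aeval_genericElement_generalCharpoly,
    ← hsign, map_mul, map_neg, zero_sub]
  exact Algebra.smul_def (R := PolyRing K A) (A := PolyRing K A ⊗[K] A) _ _

/-- Apply the character to `b * adj b = n(b)`. -/
theorem exists_dvd_normPoly_pow_of_isCharacter [Infinite K] {χ : A → K} (hχ : IsCharacter χ)
    {p : PolyRing K A} (hp : ∀ a : A, χ a = MvPolynomial.eval (coords K a) p) :
    ∃ n : ℕ, p ∣ normPoly K A ^ n := by
  obtain ⟨n, hn⟩ := exists_algebraMap_eq_pow_of_isCharacter hχ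
  let adj := (Algebra.TensorProduct.basis (PolyRing K A) (basis K A)).repr (genericAdjoint K A)
  refine ⟨n, MvPolynomial.aeval adj p, MvPolynomial.funext fun y => ?_⟩
  let b : A := ∑ i, y i • basis K A i
  have hadj : MvPolynomial.eval y (MvPolynomial.aeval adj p) =
      χ (evalAt K b (genericAdjoint K A)) := by
    rw [mvPolynomial_eval_aeval, hp, ← coords_sum y]
    exact congrArg (MvPolynomial.eval · p) (funext fun i => (coords_evalAt K _ _ i).symm)
  have hnorm : b * evalAt K b (genericAdjoint K A) = algebraMap K A (reducedNorm K b) := by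
    nth_rw 1 [← evalAt_genericElement K b]
    rw [← map_mul, genericElement_mul_genericAdjoint, reducedNorm_eq_eval]
    exact specialize_algebraMap _ _ _
  rw [map_mul, map_pow, hadj, ← coords_sum y, ← hp, ← reducedNorm_eq_eval, ← hn, ← hnorm,
    hχ.map_mul]

theorem exists_eq_reducedNorm_pow_of_isCharacter [Infinite K] (hirr : Irreducible (normPoly K A))
    {χ : A → K} (hχ : IsCharacter χ) : ∃ t : ℕ, ∀ a : A, χ a = reducedNorm K a ^ t := by
  obtain ⟨p, hp⟩ := hχ.polynomial
  obtain ⟨n, hn⟩ := exists_dvd_normPoly_pow_of_isCharacter hχ hp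
  obtain ⟨t, -, u, hu⟩ := (dvd_prime_pow hirr.prime n).1 hn
  obtain ⟨c, -, hc⟩ := MvPolynomial.isUnit_iff_eq_C_of_isReduced.1 u.isUnit
  have hχ' (a : A) : χ a * c = reducedNorm K a ^ t := by
    rw [hp, reducedNorm_eq_eval, ← map_pow, ← hu, map_mul, hc, MvPolynomial.eval_C]
  have hc1 : c = 1 := by
    simpa only [hχ.map_one, reducedNorm_one, one_pow, one_mul] using hχ' 1
  exact ⟨t, fun a => by rw [← hχ', hc1, mul_one]⟩

end Character

section Tower

variable {K C : Type*} [Field K] [Field C] [Algebra K C] [FiniteDimensional K C]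

theorem exists_sum_map_mul_C_basis_eq (P : C[X]) : ∃ y : Idx K C → K[X],
    (∀ i, (y i).natDegree ≤ P.natDegree) ∧
      ∑ i, (y i).map (algebraMap K C) * Polynomial.C (basis K C i) = P := by
  refine ⟨fun i => ∑ j ∈ Finset.range (P.natDegree + 1), monomial j (coords K (P.coeff j) i),
    fun i => natDegree_sum_le_of_forall_le _ _ fun j hj =>
      (natDegree_monomial_le _).trans (Nat.lt_succ_iff.1 (Finset.mem_range.1 hj)), ?_⟩
  have hcoeff (j : ℕ) : ∑ i, algebraMap K C (coords K (P.coeff j) i) * basis K C i = P.coeff j := by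
    simp only [← Algebra.smul_def, sum_coords_smul]
  simp only [Polynomial.map_sum, map_monomial, Finset.sum_mul, monomial_mul_C]
  rw [Finset.sum_comm]
  simp only [← map_sum, hcoeff]
  exact (as_sum_range P).symm

/-- The multiple of `P` is a coefficient of the specialization to `P` of the reduced characteristic
polynomial of `C`; the degree bound is the homogeneity of these coefficients. -/
theorem exists_dvd_map_natDegree_le [Infinite K] {P : C[X]} (hP : P ≠ 0) : ∃ Q : K[X], Q ≠ 0 ∧
    P ∣ Q.map (algebraMap K C) ∧ Q.natDegree ≤ reducedDegree K C * P.natDegree := by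
  obtain ⟨y, hy, hsum⟩ := exists_sum_map_mul_C_basis_eq (K := K) P
  let _ : Algebra K[X] C[X] := Polynomial.algebra K C
  have _ : IsScalarTower K K[X] C[X] := IsScalarTower.of_algebraMap_eq fun x =>
    (map_C (algebraMap K C)).symm
  let f : K[X][X] := (generalCharpoly K C).map (MvPolynomial.aeval (R := K) y).toRingHom
  have hroot : f.eval₂ (algebraMap K[X] C[X]) P = 0 := by
    have h := aeval_map_generalCharpoly (IsScalarTower.toAlgHom K C C[X]) y
    simp only [Algebra.smul_def] at h
    rwa [← aeval_def, ← hsum]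
  obtain ⟨j, hj, hdvd⟩ := Ideal.exists_coeff_ne_zero_mem_comap_of_root_mem hP
    (Ideal.mem_span_singleton_self P) (monic_map_generalCharpoly _).ne_zero hroot
  refine ⟨f.coeff j, hj, Ideal.mem_span_singleton.1 hdvd, ?_⟩
  rw [coeff_map]
  exact MvPolynomial.aeval_natDegree_le _
    ((isHomogeneous_coeff_generalCharpoly K C j).totalDegree_le.trans (Nat.sub_le _ _)) _ hy

theorem reducedDegree_le_mul [Infinite K] (A : Type*) [Ring A] [Algebra K A] [Algebra C A]
    [IsScalarTower K C A] [FiniteDimensional K A] [FiniteDimensional C A] :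
    reducedDegree K A ≤ reducedDegree K C * reducedDegree C A := by
  obtain ⟨a, ha⟩ := exists_isRegular K A
  obtain ⟨Q, hQ, hdvd, hdeg⟩ := exists_dvd_map_natDegree_le (K := K)
    (minpoly.ne_zero (IsIntegral.of_finite C a))
  have hroot : aeval a Q = 0 := by
    rw [← aeval_map_algebraMap C]
    exact minpoly.dvd_iff.1 hdvd
  calc reducedDegree K A = (minpoly K a).natDegree := ha.symm
    _ ≤ Q.natDegree := natDegree_minpoly_le_of_aeval_eq_zero hQ hroot
    _ ≤ reducedDegree K C * (minpoly C a).natDegree := hdeg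
    _ ≤ reducedDegree K C * reducedDegree C A :=
      Nat.mul_le_mul_left _ (natDegree_minpoly_le_reducedDegree a)

end Tower

section SimpleBaseChange

open TensorProduct

variable {C L A : Type*} [Field C] [Field L] [Algebra C L] [Ring A] [Algebra C A]

theorem exists_eq_tmul_one_of_commute [Algebra.IsCentral C A] {x : L ⊗[C] A}
    (hx : ∀ a : A, Commute (1 ⊗ₜ a) x) : ∃ l : L, x = l ⊗ₜ 1 := by
  have hcentral : x ∈ Subalgebra.centralizer C
      (Algebra.TensorProduct.includeRight : A →ₐ[C] L ⊗[C] A).range := by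
    rintro _ ⟨a, rfl⟩
    exact hx a
  rw [Subalgebra.centralizer_range_includeRight_eq_center_tensorProduct] at hcentral
  obtain ⟨y, rfl⟩ := hcentral
  clear hx
  induction y with
  | zero => exact ⟨0, by rw [map_zero, zero_tmul]⟩
  | tmul l a =>
    obtain ⟨c, hc⟩ := (Algebra.IsCentral.mem_center_iff C).1 a.2
    refine ⟨c • l, ?_⟩
    rw [smul_tmul, ← Algebra.algebraMap_eq_smul_one, ← hc]
    rfl
  | add y z hy hz =>
    obtain ⟨l, hl⟩ := hy
    obtain ⟨m, hm⟩ := hz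
    exact ⟨l + m, by rw [map_add, hl, hm, add_tmul]⟩

variable {ι : Type*} [DecidableEq ι] (b : Module.Basis ι C L)

theorem equivFinsuppOfBasisLeft_one_tmul_mul (a : A) (x : L ⊗[C] A) (i : ι) :
    equivFinsuppOfBasisLeft b ((1 ⊗ₜ a) * x) i = a * equivFinsuppOfBasisLeft b x i := by
  induction x with
  | zero => simp
  | tmul l a => simp [Algebra.TensorProduct.tmul_mul_tmul]
  | add x y hx hy => simp only [mul_add, map_add, Finsupp.add_apply, hx, hy]

theorem equivFinsuppOfBasisLeft_mul_one_tmul (a : A) (x : L ⊗[C] A) (i : ι) :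
    equivFinsuppOfBasisLeft b (x * (1 ⊗ₜ a)) i = equivFinsuppOfBasisLeft b x i * a := by
  induction x with
  | zero => simp
  | tmul l a => simp [Algebra.TensorProduct.tmul_mul_tmul]
  | add x y hx hy => simp only [add_mul, map_add, Finsupp.add_apply, hx, hy]

variable {b}

theorem exists_mem_equivFinsuppOfBasisLeft_eq_one [IsSimpleRing A] {I : TwoSidedIdeal (L ⊗[C] A)}
    {x : L ⊗[C] A} (hx : x ∈ I) {i : ι} (hi : equivFinsuppOfBasisLeft b x i ≠ 0) :
    ∃ y ∈ I, equivFinsuppOfBasisLeft b y i = 1 ∧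
      (equivFinsuppOfBasisLeft b y).support ⊆ (equivFinsuppOfBasisLeft b x).support := by
  let J : TwoSidedIdeal A := .mk'
    {a | ∃ y ∈ I, equivFinsuppOfBasisLeft b y i = a ∧
      ∀ j, equivFinsuppOfBasisLeft b x j = 0 → equivFinsuppOfBasisLeft b y j = 0}
    ⟨0, I.zero_mem, by simp⟩
    (by
      rintro _ _ ⟨y, hy, rfl, hysupp⟩ ⟨z, hz, rfl, hzsupp⟩
      refine ⟨y + z, I.add_mem hy hz, by simp, fun j hj => ?_⟩
      rw [map_add, Finsupp.add_apply, hysupp j hj, hzsupp j hj, add_zero])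
    (by
      rintro _ ⟨y, hy, rfl, hysupp⟩
      refine ⟨-y, I.neg_mem hy, by simp, fun j hj => ?_⟩
      rw [map_neg, Finsupp.neg_apply, hysupp j hj, neg_zero])
    (by
      rintro a _ ⟨y, hy, rfl, hysupp⟩
      refine ⟨(1 ⊗ₜ a) * y, I.mul_mem_left _ _ hy, equivFinsuppOfBasisLeft_one_tmul_mul b a y i,
        fun j hj => ?_⟩
      rw [equivFinsuppOfBasisLeft_one_tmul_mul, hysupp j hj, mul_zero])
    (by
      rintro _ a ⟨y, hy, rfl, hysupp⟩
      refine ⟨y * (1 ⊗ₜ a), I.mul_mem_right _ _ hy, equivFinsuppOfBasisLeft_mul_one_tmul b a y i,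
        fun j hj => ?_⟩
      rw [equivFinsuppOfBasisLeft_mul_one_tmul, hysupp j hj, zero_mul])
  have hmem : equivFinsuppOfBasisLeft b x i ∈ J :=
    (TwoSidedIdeal.mem_mk' _ _ _ _ _ _ _).2 ⟨x, hx, rfl, fun _ => id⟩
  obtain ⟨y, hy, hyi, hysupp⟩ := (TwoSidedIdeal.mem_mk' _ _ _ _ _ _ _).1
    (IsSimpleRing.one_mem_of_ne_zero_mem J hi hmem)
  refine ⟨y, hy, hyi, fun j hj => ?_⟩
  rw [Finsupp.mem_support_iff] at hj ⊢
  exact mt (hysupp j) hj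

variable (C L A) in
/-- An element of minimal support in a nonzero ideal, scaled to have a coordinate `1`, has support
too small for its commutators with `A` to be nonzero. -/
theorem isSimpleRing_tensorProduct [IsSimpleRing A] [Algebra.IsCentral C A] :
    IsSimpleRing (L ⊗[C] A) := by
  classical
  refine IsSimpleRing.of_eq_bot_or_eq_top fun I => or_iff_not_imp_left.2 fun hI => ?_
  let T := equivFinsuppOfBasisLeft (N := A) (Module.Basis.ofVectorSpace C L)
  obtain ⟨x₀, hx₀, hx₀0⟩ := SetLike.exists_of_lt (bot_lt_iff_ne_bot.2 hI)
  obtain ⟨x, ⟨hx, hx0⟩, hmin⟩ := exists_minimalFor_of_wellFoundedLT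
    (fun x => x ∈ I ∧ x ≠ 0) (fun x => (T x).support) ⟨x₀, hx₀, hx₀0⟩
  obtain ⟨i, hi⟩ := Finsupp.support_nonempty_iff.2 ((LinearEquiv.map_ne_zero_iff T).2 hx0)
  obtain ⟨y, hy, hyi, hysupp⟩ :=
    exists_mem_equivFinsuppOfBasisLeft_eq_one hx (Finsupp.mem_support_iff.1 hi)
  have hcomm (a : A) : Commute (1 ⊗ₜ a) y := by
    by_contra h
    let z := (1 ⊗ₜ a) * y - y * (1 ⊗ₜ a)
    have hz (j) : T z j = a * T y j - T y j * a := by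
      rw [← equivFinsuppOfBasisLeft_one_tmul_mul, ← equivFinsuppOfBasisLeft_mul_one_tmul,
        ← Finsupp.sub_apply, ← map_sub]
    have hzsupp : (T z).support ⊆ (T x).support := fun j hj => by
      refine hysupp (Finsupp.mem_support_iff.2 fun hyj => Finsupp.mem_support_iff.1 hj ?_)
      rw [hz, hyj, mul_zero, zero_mul, sub_zero]
    refine Finsupp.mem_support_iff.1
      (hmin ⟨I.sub_mem (I.mul_mem_left _ _ hy) (I.mul_mem_right _ _ hy), sub_ne_zero.2 h⟩ hzsupp hi)
      ?_
    rw [hz, hyi, mul_one, one_mul, sub_self]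
  obtain ⟨l, rfl⟩ := exists_eq_tmul_one_of_commute hcomm
  have hl : l ≠ 0 := by
    rintro rfl
    rw [zero_tmul, map_zero, Finsupp.zero_apply] at hyi
    exact zero_ne_one hyi
  rw [← TwoSidedIdeal.one_mem_iff]
  have hone := I.mul_mem_left (l⁻¹ ⊗ₜ 1) _ hy
  rwa [Algebra.TensorProduct.tmul_mul_tmul, inv_mul_cancel₀ hl, mul_one] at hone

end SimpleBaseChange

section CentralSimple

variable {C L A : Type*} [Field C] [Field L] [Algebra C L] [Ring A] [Algebra C A]

theorem aeval_diagonal {n : Type*} [Fintype n] [DecidableEq n] (t : n → L) (f : L[X]) :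
    aeval (Matrix.diagonal t) f = Matrix.diagonal fun i => f.eval (t i) := by
  have hdiag := aeval_algHom_apply (Matrix.diagonalAlgHom (n := n) L (α := L)) t f
  rw [Matrix.diagonalAlgHom_apply, Matrix.diagonalAlgHom_apply] at hdiag
  rw [hdiag]
  congr 1
  funext i
  have hi := aeval_algHom_apply (Pi.evalAlgHom L (fun _ : n => L) i) t f
  simpa only [Pi.evalAlgHom_apply, coe_aeval_eq_eval] using hi.symm

variable [FiniteDimensional C A]

theorem reducedDegree_le_of_algEquiv [Infinite C] {r : ℕ}
    (e : L ⊗[C] A ≃ₐ[L] Matrix (Fin r) (Fin r) L) : reducedDegree C A ≤ r := by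
  obtain ⟨a, ha⟩ := exists_isRegular C A
  have hpow : LinearIndependent L
      fun i : Fin (reducedDegree C A) => ((1 : L) ⊗ₜ[C] a) ^ (i : ℕ) := by
    simp only [Algebra.TensorProduct.tmul_pow, one_pow]
    exact Module.Flat.linearIndependent_one_tmul (ha ▸ linearIndependent_pow a)
  have hroot : aeval ((1 : L) ⊗ₜ[C] a) (e (1 ⊗ₜ a)).charpoly = 0 := by
    apply e.injective
    rw [map_zero, ← Matrix.aeval_self_charpoly (e (1 ⊗ₜ a))]
    exact (aeval_algHom_apply e.toAlgHom _ _).symm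
  calc reducedDegree C A ≤ (e (1 ⊗ₜ a)).charpoly.natDegree :=
        le_natDegree_of_linearIndependent_pow hpow (Matrix.charpoly_monic _).ne_zero hroot
    _ = r := by rw [Matrix.charpoly_natDegree_eq_dim, Fintype.card_fin]

theorem exists_map_generalCharpoly_eq_prod [Infinite C] {r : ℕ}
    (e : L ⊗[C] A ≃ₐ[L] Matrix (Fin r) (Fin r) L) {t : Fin r → L} (ht : Function.Injective t) :
    ∃ y : Idx C A → L, (generalCharpoly C A).map (MvPolynomial.aeval (R := C) y).toRingHom =
      ∏ i, (X - Polynomial.C (t i)) := by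
  let bL := Algebra.TensorProduct.basis L (basis C A)
  let y : Idx C A → L := bL.repr (e.symm (Matrix.diagonal t))
  let f := (generalCharpoly C A).map (MvPolynomial.aeval (R := C) y).toRingHom
  have hy : ∑ i, y i • Algebra.TensorProduct.includeRight (R := C) (A := L) (basis C A i) =
      e.symm (Matrix.diagonal t) := by
    conv_rhs => rw [← bL.sum_repr (e.symm (Matrix.diagonal t))]
    simp only [bL, y, Algebra.TensorProduct.basis_apply, Algebra.TensorProduct.includeRight_apply]
  have hdiag : Matrix.diagonal (fun i => f.eval (t i)) = 0 := by
    have h := aeval_map_generalCharpoly (Algebra.TensorProduct.includeRight (R := C) (A := L)) y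
    rw [hy, ← AlgEquiv.coe_toAlgHom, aeval_algHom_apply, aeval_diagonal] at h
    exact e.symm.injective (h.trans (map_zero _).symm)
  have hdvd : ∏ i, (X - Polynomial.C (t i)) ∣ f :=
    Finset.prod_dvd_of_coprime (fun i _ j _ hij => pairwise_coprime_X_sub_C ht hij) fun i _ =>
      dvd_iff_isRoot.2 (congrFun (Matrix.diagonal_eq_zero.1 hdiag) i)
  refine ⟨y, eq_of_monic_of_dvd_of_natDegree_le
    (monic_prod_of_monic _ _ fun i _ => monic_X_sub_C _) (monic_map_generalCharpoly _) hdvd ?_⟩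
  rw [natDegree_map_generalCharpoly, natDegree_finsetProd_X_sub_C_eq_card, Finset.card_univ,
    Fintype.card_fin]
  exact reducedDegree_le_of_algEquiv e

variable (C L) in
theorem exists_injective_fin [Infinite C] (r : ℕ) : ∃ t : Fin r → L, Function.Injective t :=
  ⟨fun i => algebraMap C L (Infinite.natEmbedding C i), (algebraMap C L).injective.comp
    ((Infinite.natEmbedding C).injective.comp Fin.val_injective)⟩

theorem reducedDegree_eq_of_algEquiv [Infinite C] {r : ℕ}
    (e : L ⊗[C] A ≃ₐ[L] Matrix (Fin r) (Fin r) L) : reducedDegree C A = r := by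
  obtain ⟨t, ht⟩ := exists_injective_fin C L r
  obtain ⟨y, hy⟩ := exists_map_generalCharpoly_eq_prod e ht
  have hdeg := congrArg natDegree hy
  rwa [natDegree_map_generalCharpoly, natDegree_finsetProd_X_sub_C_eq_card, Finset.card_univ,
    Fintype.card_fin] at hdeg

variable (C A)

theorem reducedDegree_pos [Nontrivial A] : 0 < reducedDegree C A :=
  (minpoly.natDegree_pos (IsIntegral.of_finite C (1 : A))).trans_le
    (natDegree_minpoly_le_reducedDegree (1 : A))

variable [IsSimpleRing A] [Algebra.IsCentral C A]

theorem exists_algEquiv_matrix_algebraicClosure : ∃ r : ℕ, Nonempty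
    (AlgebraicClosure C ⊗[C] A ≃ₐ[AlgebraicClosure C]
      Matrix (Fin r) (Fin r) (AlgebraicClosure C)) := by
  have _ := isSimpleRing_tensorProduct C (AlgebraicClosure C) A
  obtain ⟨r, -, he⟩ := IsSimpleRing.exists_algEquiv_matrix_of_isAlgClosed (AlgebraicClosure C)
    (AlgebraicClosure C ⊗[C] A)
  exact ⟨r, he⟩

variable [Infinite C]

theorem reducedDegree_sq_eq_finrank : reducedDegree C A ^ 2 = Module.finrank C A := by
  obtain ⟨r, ⟨e⟩⟩ := exists_algEquiv_matrix_algebraicClosure C A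
  rw [reducedDegree_eq_of_algEquiv e, ← Module.finrank_baseChange (R := AlgebraicClosure C),
    e.toLinearEquiv.finrank_eq, Module.finrank_matrix, Module.finrank_self, Fintype.card_fin,
    mul_one, sq]

theorem reducedDegree_matrix_of_isCentral (n : Type*) [Fintype n] [DecidableEq n] [Nonempty n] :
    reducedDegree C (Matrix n n A) = Fintype.card n * reducedDegree C A := by
  refine Nat.pow_left_injective two_ne_zero ?_
  beta_reduce
  rw [mul_pow, reducedDegree_sq_eq_finrank, reducedDegree_sq_eq_finrank, Module.finrank_matrix, sq]

theorem derivative_generalCharpoly_ne_zero : derivative (generalCharpoly C A) ≠ 0 := by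
  obtain ⟨r, ⟨e⟩⟩ := exists_algEquiv_matrix_algebraicClosure C A
  obtain ⟨t, ht⟩ := exists_injective_fin C (AlgebraicClosure C) r
  obtain ⟨y, hy⟩ := exists_map_generalCharpoly_eq_prod e ht
  intro hzero
  have hsep := separable_prod_X_sub_C_iff.2 ht
  rw [← hy, Separable, derivative_map, hzero, Polynomial.map_zero, isCoprime_zero_right] at hsep
  have hdeg := natDegree_eq_zero_of_isUnit hsep
  rw [natDegree_map_generalCharpoly] at hdeg
  exact (reducedDegree_pos C A).ne' hdeg

end CentralSimple

theorem exists_isRegular_isSeparable (C D : Type*) [Field C] [Infinite C] [DivisionRing D]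
    [Algebra C D] [FiniteDimensional C D] [Algebra.IsCentral C D] :
    ∃ b : D, IsRegular C b ∧ IsSeparable C b := by
  by_contra! hinsep
  refine derivative_generalCharpoly_ne_zero C D (Polynomial.ext fun i => ?_)
  refine eq_of_eval_coords_eq_of_isRegular fun b hb => ?_
  have hder : derivative (reducedCharpoly C b) = 0 := by
    rw [hb.reducedCharpoly_eq_minpoly]
    by_contra hne
    exact hinsep b hb ((separable_iff_derivative_ne_zero
      (minpoly.irreducible (IsIntegral.of_finite C b))).2 hne)
  rw [← coeff_map, ← derivative_map, ← reducedCharpoly, hder, coeff_zero, coeff_zero, map_zero]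

section PrimitiveElement

open IntermediateField

theorem mem_of_isSeparable_of_unique_root {F E : Type*} [Field F] [Field E] [Algebra F E]
    (G : IntermediateField F E) {β : E} (hβ : IsSeparable F β)
    (huniq : ∀ β' : AlgebraicClosure E, (∀ p : G[X], aeval β p = 0 → aeval β' p = 0) →
      β' = algebraMap E _ β) : β ∈ G := by
  let L := AlgebraicClosure E
  have hmin : minpoly G (algebraMap E L β) = minpoly G β :=
    minpoly.algebraMap_eq (algebraMap E L).injective β
  have hsep : IsSeparable G (algebraMap E L β) := by
    rw [IsSeparable, hmin]
    exact hβ.tower_top G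
  have hbot : algebraMap E L β ∈ (⊥ : Subalgebra G L) := by
    by_contra hnot
    obtain ⟨β', hne, hconj⟩ :=
      (notMem_iff_exists_ne_and_isConjRoot hsep (IsAlgClosed.splits _)).1 hnot
    refine hne (huniq β' fun p hp => ?_).symm
    exact aeval_eq_zero_of_dvd_aeval_eq_zero (minpoly.dvd G β hp) (hmin ▸ hconj.aeval_eq_zero)
  obtain ⟨b, hb⟩ := hbot
  exact (algebraMap E L).injective hb ▸ b.2

theorem exists_mem_adjoin_add_smul {F E : Type*} [Field F] [Infinite F] [Field E] [Algebra F E]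
    {α β : E} (hα : IsIntegral F α) (hβ : IsSeparable F β) :
    ∃ c : F, α ∈ F⟮α + c • β⟯ ∧ β ∈ F⟮α + c • β⟯ := by
  let L := AlgebraicClosure E
  let ι := algebraMap E L
  obtain ⟨c, hc⟩ := Field.primitive_element_inf_aux_exists_c (algebraMap F L) (ι α) (ι β)
    (minpoly F α) (minpoly F β)
  have hroots {x : E} (hx : IsIntegral F x) {y : L} (hy : aeval y (minpoly F x) = 0) :
      y ∈ ((minpoly F x).map (algebraMap F L)).roots :=
    (mem_roots_map (minpoly.ne_zero hx)).2 hy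
  set γ := α + c • β with hγ
  have hβmem : β ∈ F⟮γ⟯ := by
    -- A conjugate `δ ≠ β` over `F⟮γ⟯` would make `γ - c • δ` a conjugate of `α`, against the choice
    -- of `c`.
    refine mem_of_isSeparable_of_unique_root F⟮γ⟯ hβ fun β' hβ' => ?_
    have hβroot : aeval β' (minpoly F β) = 0 := by
      have h := hβ' ((minpoly F β).map (algebraMap F F⟮γ⟯))
      simp only [aeval_map_algebraMap] at h
      exact h (minpoly.aeval F β)
    have hαroot : aeval (ι γ - c • β') (minpoly F α) = 0 := by
      have h := hβ' (((minpoly F α).map (algebraMap F F⟮γ⟯)).comp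
        (C (AdjoinSimple.gen F γ) - C (algebraMap F F⟮γ⟯ c) * X))
      simp only [aeval_comp, aeval_map_algebraMap, map_sub, map_mul, aeval_C, aeval_X,
        ← IsScalarTower.algebraMap_apply, AdjoinSimple.algebraMap_gen, ← Algebra.smul_def] at h
      refine h ?_
      rw [hγ, add_sub_cancel_right, minpoly.aeval]
    by_contra hne
    have hconj : -(ι γ - c • β' - ι α) = algebraMap F L c * (β' - ι β) := by
      rw [hγ, map_add, Algebra.smul_def, Algebra.smul_def, map_mul,
        ← IsScalarTower.algebraMap_apply F E L]
      ring
    refine hc _ (hroots hα hαroot) _ (hroots hβ.isIntegral hβroot) ?_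
    rwa [div_eq_iff (sub_ne_zero.2 hne)]
  refine ⟨c, ?_, hβmem⟩
  have hsub := sub_mem (mem_adjoin_simple_self F γ) (F⟮γ⟯.smul_mem hβmem (x := c))
  rwa [hγ, add_sub_cancel_right] at hsub

section FieldTower

variable {K C M : Type*} [Field K] [Field C] [Field M] [Algebra K C] [Algebra C M] [Algebra K M]
  [IsScalarTower K C M] [FiniteDimensional K M]

theorem exists_isSeparable_adjoin_eq {w : M} (hw : IsSeparable C w) :
    ∃ v : M, IsSeparable K v ∧ C⟮v⟯ = C⟮w⟯ := by
  have : FiniteDimensional C M := FiniteDimensional.right K C M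
  obtain ⟨q, hq⟩ := ExpChar.exists K
  have hqC : ExpChar C q := expChar_of_injective_algebraMap (algebraMap K C).injective q
  have hqS : ExpChar (separableClosure K M) q :=
    expChar_of_injective_algebraMap (algebraMap K (separableClosure K M)).injective q
  obtain ⟨n, v, hv⟩ := (isPurelyInseparable_iff_pow_mem (separableClosure K M) (E := M) q).1
    (separableClosure.isPurelyInseparable K M) w
  exact ⟨w ^ q ^ n, hv ▸ mem_separableClosure_iff.1 v.2,
    (adjoin_simple_eq_adjoin_pow_expChar_pow_of_isSeparable C M hw q n).symm⟩

theorem natDegree_minpoly_mul_le_finrank (E : IntermediateField K M) {z : C} {v : M}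
    (hz : algebraMap C M z ∈ E) (hv : v ∈ E) :
    (minpoly K z).natDegree * (minpoly C v).natDegree ≤ Module.finrank K E := by
  have hli := linearIndependent_smul (linearIndependent_pow (K := K) z)
    (linearIndependent_pow (K := C) v)
  have hmem (i j : ℕ) : z ^ i • v ^ j ∈ E := by
    rw [Algebra.smul_def, map_pow]
    exact mul_mem (pow_mem hz i) (pow_mem hv j)
  have hliE := LinearIndependent.of_comp E.val.toLinearMap
    (v := fun ij : Fin _ × Fin _ => (⟨_, hmem ij.1 ij.2⟩ : E)) hli
  simpa only [Fintype.card_prod, Fintype.card_fin] using hliE.fintype_card_le_finrank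

theorem exists_mul_le_natDegree_minpoly [Infinite K] (z : C) {w : M} (hw : IsSeparable C w) :
    ∃ x : M, (minpoly K z).natDegree * (minpoly C w).natDegree ≤ (minpoly K x).natDegree := by
  have : FiniteDimensional C M := FiniteDimensional.right K C M
  obtain ⟨v, hv, hvw⟩ := exists_isSeparable_adjoin_eq (K := K) hw
  obtain ⟨c, hzmem, hvmem⟩ :=
    exists_mem_adjoin_add_smul (IsIntegral.of_finite K (algebraMap C M z)) hv
  refine ⟨algebraMap C M z + c • v, ?_⟩
  have hdeg : (minpoly C v).natDegree = (minpoly C w).natDegree := by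
    rw [← adjoin.finrank (IsIntegral.of_finite C v), ← adjoin.finrank (IsIntegral.of_finite C w),
      hvw]
  rw [← hdeg, ← adjoin.finrank (IsIntegral.of_finite K (_ + _))]
  exact natDegree_minpoly_mul_le_finrank _ hzmem hvmem

end FieldTower

end PrimitiveElement

section DivisionRing

variable {K C D : Type*} [Field K] [Infinite K] [Field C] [DivisionRing D] [Algebra K C]
  [Algebra C D] [Algebra K D] [IsScalarTower K C D] [FiniteDimensional K C] [FiniteDimensional C D]

theorem exists_mul_le_natDegree_minpoly_of_divisionRing (z : C) {w : D} (hw : IsSeparable C w) :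
    ∃ x : D, (minpoly K z).natDegree * (minpoly C w).natDegree ≤ (minpoly K x).natDegree := by
  have hint : IsIntegral C w := IsIntegral.of_finite C w
  have hirr : Fact (Irreducible (minpoly C w)) := ⟨minpoly.irreducible hint⟩
  have hfin : FiniteDimensional C (AdjoinRoot (minpoly C w)) :=
    (AdjoinRoot.powerBasis hirr.out.ne_zero).finite
  have hfinK : FiniteDimensional K (AdjoinRoot (minpoly C w)) := FiniteDimensional.trans K C _
  let ι : AdjoinRoot (minpoly C w) →ₐ[C] D :=
    Ideal.Quotient.liftₐ (Ideal.span {minpoly C w}) (aeval w) fun p hp => by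
      obtain ⟨q, rfl⟩ := Ideal.mem_span_singleton.1 hp
      rw [map_mul, minpoly.aeval, zero_mul]
  have hι : ι (AdjoinRoot.root _) = w := aeval_X w
  have hinj : Function.Injective ι := ι.toRingHom.injective
  have hroot : minpoly C (AdjoinRoot.root (minpoly C w)) = minpoly C w := by
    conv_rhs => rw [← hι, minpoly.algHom_eq ι hinj]
  have hsep : IsSeparable C (AdjoinRoot.root (minpoly C w)) := by rwa [IsSeparable, hroot]
  obtain ⟨x, hx⟩ := exists_mul_le_natDegree_minpoly (K := K) z hsep
  refine ⟨ι x, ?_⟩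
  have hmin : minpoly K (ι x) = minpoly K x := minpoly.algHom_eq (ι.restrictScalars K) hinj x
  rwa [hmin, ← congrArg natDegree hroot]

variable (K C D) in
theorem reducedDegree_divisionRing [FiniteDimensional K D] [Algebra.IsCentral C D] :
    reducedDegree K D = reducedDegree K C * reducedDegree C D := by
  have : Infinite C := Infinite.of_injective _ (algebraMap K C).injective
  refine le_antisymm (reducedDegree_le_mul D) ?_
  obtain ⟨z, hz⟩ := exists_isRegular K C
  obtain ⟨w, hw, hsep⟩ := exists_isRegular_isSeparable C D
  obtain ⟨x, hx⟩ := exists_mul_le_natDegree_minpoly_of_divisionRing (K := K) z hsep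
  rw [hz, hw] at hx
  exact hx.trans (natDegree_minpoly_le_reducedDegree x)

end DivisionRing

section Companion

variable {K A : Type*} [Field K] [Ring A] [Algebra K A]

/-- The companion matrix of `X ^ k - v`, with ones below the diagonal and `v` in the upper right
corner. Column `c` holds `v ^ ((c + 1) / k)` in row `(c + 1) % k`, a form inherited by powers. -/
def companion (k : ℕ) (v : A) : Matrix (Fin k) (Fin k) A :=
  Matrix.of fun r c => if r.val = (c.val + 1) % k then v ^ ((c.val + 1) / k) else 0

theorem companion_pow_apply (k : ℕ) (v : A) (n : ℕ) (r c : Fin k) :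
    (companion k v ^ n) r c = if r.val = (c.val + n) % k then v ^ ((c.val + n) / k) else 0 := by
  have hk : 0 < k := r.pos
  induction n generalizing r with
  | zero =>
    rw [pow_zero, add_zero, Nat.mod_eq_of_lt c.2, Nat.div_eq_of_lt c.2, pow_zero, Matrix.one_apply]
    simp only [Fin.ext_iff]
  | succ n ih =>
    have hdiv : ((c + n) % k + 1) / k + (c + n) / k = (c + (n + 1)) / k := by
      rw [← Nat.add_mul_div_left _ _ hk, add_right_comm, Nat.mod_add_div, add_assoc]
    rw [pow_succ', Matrix.mul_apply,
      Finset.sum_eq_single_of_mem ⟨(c + n) % k, Nat.mod_lt _ hk⟩ (Finset.mem_univ _)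
        fun j _ hj => by rw [ih, if_neg fun h => hj (Fin.ext h), mul_zero],
      ih, if_pos rfl, companion, Matrix.of_apply, ite_mul, zero_mul, Nat.mod_add_mod, add_assoc,
      ← pow_add, hdiv]

theorem companion_smul (k : ℕ) (w : A) (s : K) :
    companion k (s • w) = companion k 0 + s • (companion k w - companion k 0) := by
  ext r c
  simp only [companion, Matrix.add_apply, Matrix.smul_apply, Matrix.sub_apply, Matrix.of_apply]
  rcases (show c.val + 1 ≤ k from c.2).lt_or_eq with hc | hc
  · rw [Nat.div_eq_of_lt hc]
    simp only [pow_zero, sub_self, smul_zero, add_zero]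
  · rw [hc, Nat.div_self r.pos]
    simp only [pow_one, ite_self, sub_zero, zero_add, smul_ite, smul_zero]

theorem companion_pow_self (k : ℕ) (v : A) :
    companion k v ^ k = Matrix.diagonalAlgHom K (Pi.constAlgHom K (Fin k) A v) := by
  ext r c
  rw [companion_pow_apply, Nat.add_mod_right, Nat.mod_eq_of_lt c.2, Nat.add_div_right _ r.pos,
    Nat.div_eq_of_lt c.2, pow_one, Matrix.diagonalAlgHom_apply, Matrix.diagonal_apply]
  simp only [Fin.ext_iff, Pi.constAlgHom_apply, Function.const_apply]

theorem linearIndependent_companion_pow {k n : ℕ} (hk : 0 < k) {v : A}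
    (hv : LinearIndependent K fun i : Fin n => v ^ (i : ℕ)) :
    LinearIndependent K fun i : Fin (n * k) => companion k v ^ (i : ℕ) := by
  have hcol (j : Fin n) (r' r : Fin k) : (companion k v ^ (finProdFinEquiv (j, r')).val) r ⟨0, hk⟩ =
      if r = r' then v ^ (j : ℕ) else 0 := by
    rw [companion_pow_apply, finProdFinEquiv_apply_val, zero_add, Nat.add_mul_mod_self_left,
      Nat.mod_eq_of_lt r'.2, Nat.add_mul_div_left _ _ hk, Nat.div_eq_of_lt r'.2, zero_add]
    simp only [Fin.ext_iff]
  rw [← linearIndependent_equiv finProdFinEquiv, Fintype.linearIndependent_iff]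
  rintro c hc ⟨j, r⟩
  refine Fintype.linearIndependent_iff.1 hv (fun j => c (j, r)) ?_ j
  have hentry := congrFun (congrFun hc r) ⟨0, hk⟩
  simpa only [Matrix.sum_apply, Fintype.sum_prod_type, Function.comp_apply, Matrix.smul_apply, hcol,
    smul_ite, smul_zero, Finset.sum_ite_eq, Finset.mem_univ, if_true, Matrix.zero_apply]
    using hentry

theorem minpoly_companion [FiniteDimensional K A] {k : ℕ} (hk : 0 < k) (v : A) :
    minpoly K (companion k v) = expand K k (minpoly K v) := by
  have hmonic : (expand K k (minpoly K v)).Monic :=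
    (minpoly.monic (IsIntegral.of_finite K v)).expand hk
  have hroot : aeval (companion k v) (expand K k (minpoly K v)) = 0 := by
    rw [expand_aeval, companion_pow_self (K := K), aeval_algHom_apply, aeval_algHom_apply,
      minpoly.aeval, map_zero, map_zero]
  refine (eq_minpoly_of_natDegree_le hmonic hroot ?_).symm
  have hli := linearIndependent_companion_pow (K := K) hk (linearIndependent_pow v)
  rw [natDegree_expand]
  exact le_natDegree_of_linearIndependent_pow hli
    (minpoly.ne_zero (IsIntegral.of_finite K (companion k v))) (minpoly.aeval K (companion k v))

theorem natDegree_minpoly_companion [FiniteDimensional K A] {k : ℕ} (hk : 0 < k) (v : A) :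
    (minpoly K (companion k v)).natDegree = k * (minpoly K v).natDegree := by
  rw [minpoly_companion hk, natDegree_expand, mul_comm]

end Companion

section MatrixDivisionRing

variable {K C D : Type*} [Field K] [Infinite K] [Field C] [DivisionRing D] [Algebra K C]
  [Algebra C D] [Algebra K D] [IsScalarTower K C D] [FiniteDimensional K C] [FiniteDimensional C D]
  [FiniteDimensional K D] [Algebra.IsCentral C D]

variable (K C D) in
theorem reducedDegree_matrix_divisionRing {k : ℕ} (hk : 0 < k) :
    reducedDegree K (Matrix (Fin k) (Fin k) D) =
      k * (reducedDegree K C * reducedDegree C D) := by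
  have : Nonempty (Fin k) := ⟨⟨0, hk⟩⟩
  have : Infinite C := Infinite.of_injective _ (algebraMap K C).injective
  refine le_antisymm ?_ ?_
  · calc reducedDegree K (Matrix (Fin k) (Fin k) D)
        ≤ reducedDegree K C * reducedDegree C (Matrix (Fin k) (Fin k) D) := reducedDegree_le_mul _
      _ = k * (reducedDegree K C * reducedDegree C D) := by
        rw [reducedDegree_matrix_of_isCentral, Fintype.card_fin, mul_left_comm]
  · obtain ⟨x, hx⟩ := exists_isRegular K D
    rw [← reducedDegree_divisionRing, ← hx, ← natDegree_minpoly_companion hk]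
    exact natDegree_minpoly_le_reducedDegree _

end MatrixDivisionRing

section Plane

variable {K : Type*} [Field K]

theorem irreducible_of_irreducible_map_of_totalDegree_le {σ R : Type*} [CommRing R] [Algebra K R]
    {N : MvPolynomial σ K} (f : MvPolynomial σ K →ₐ[K] R) (ψ : R →ₐ[K] K[X])
    (hψ : ∀ i, (ψ (f (MvPolynomial.X i))).natDegree ≤ 1)
    (hdeg : N.totalDegree ≤ (ψ (f N)).natDegree) (hN : Irreducible (f N)) : Irreducible N := by
  have hN0 : N ≠ 0 := by
    rintro rfl
    exact hN.ne_zero (map_zero f)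
  have hle (h : MvPolynomial σ K) : (ψ (f h)).natDegree ≤ h.totalDegree := by
    have := MvPolynomial.aeval_natDegree_le h le_rfl _ hψ
    rwa [mul_one, ← MvPolynomial.comp_aeval_apply, ← MvPolynomial.comp_aeval_apply,
      MvPolynomial.aeval_X_left_apply] at this
  have hunit (g h : MvPolynomial σ K) (hgh : N = g * h) (hg : IsUnit (f g)) : IsUnit g := by
    have hg0 : g ≠ 0 := left_ne_zero_of_mul (hgh ▸ hN0)
    have hh0 : h ≠ 0 := right_ne_zero_of_mul (hgh ▸ hN0)
    have hle' : g.totalDegree + h.totalDegree ≤ 0 + h.totalDegree := by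
      calc g.totalDegree + h.totalDegree = N.totalDegree := by
            rw [hgh, MvPolynomial.totalDegree_mul_of_isDomain hg0 hh0]
        _ ≤ (ψ (f g) * ψ (f h)).natDegree := by rwa [← map_mul, ← map_mul, ← hgh]
        _ ≤ (ψ (f g)).natDegree + (ψ (f h)).natDegree := natDegree_mul_le
        _ ≤ 0 + h.totalDegree :=
            add_le_add (natDegree_eq_zero_of_isUnit (hg.map ψ)).le (hle h)
    have hconst := MvPolynomial.totalDegree_eq_zero_iff_eq_C.1
      (Nat.le_zero.1 (Nat.le_of_add_le_add_right hle'))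
    rw [hconst] at hg0 ⊢
    exact (isUnit_iff_ne_zero.2 fun h => hg0 (by rw [h, map_zero])).map MvPolynomial.C
  refine ⟨fun h => hN.not_isUnit (h.map f), fun g h hgh => ?_⟩
  rcases hN.isUnit_or_isUnit (by rw [hgh, map_mul]) with hg | hh
  · exact Or.inl (hunit g h hgh hg)
  · exact Or.inr (hunit h g (hgh.trans (mul_comm g h)) hh)

theorem irreducible_scaleRoots_map_C {p : K[X]} (hp : Irreducible p) (n : ℕ) :
    Irreducible ((p.map C).scaleRoots (X ^ n : K[X])) := by
  wlog hmonic : p.Monic generalizing p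
  · have hunit : IsUnit (C p.leadingCoeff⁻¹) :=
      isUnit_C.2 (isUnit_iff_ne_zero.2 (inv_ne_zero (leadingCoeff_ne_zero.2 hp.ne_zero)))
    have := this (irreducible_mul_leadingCoeff_inv.2 hp) (monic_mul_leadingCoeff_inv hp.ne_zero)
    rwa [Polynomial.map_mul, mul_scaleRoots_of_noZeroDivisors, map_C, scaleRoots_C,
      irreducible_mul_isUnit (isUnit_C.2 hunit)] at this
  refine Monic.irreducible_of_irreducible_map (evalRingHom 1) _
    ((monic_scaleRoots_iff _).2 (hmonic.map C)) ?_
  have hid : (evalRingHom (1 : K)).comp C = RingHom.id K := RingHom.ext fun _ => eval_C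
  rw [map_scaleRoots _ _ _ (by simp [hmonic]), Polynomial.map_map, hid, Polynomial.map_id]
  simpa using hp

theorem eval_eval_scaleRoots_map_C (p r : K[X]) (s t : K) :
    (((p.map C).scaleRoots r).eval (C s)).eval t = (p.scaleRoots (r.eval t)).eval s := by
  rw [eval_eq_sum_range (p := (p.map C).scaleRoots r), eval_eq_sum_range (p := p.scaleRoots _)]
  simp only [natDegree_scaleRoots, natDegree_map, coeff_scaleRoots, coeff_map, eval_finsetSum,
    eval_mul, eval_pow, eval_C]

variable {A : Type*} [Ring A] [Algebra K A] [FiniteDimensional K A]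

/-- Restriction of a polynomial function on `A` to the plane `(s, t) ↦ t • a + b + s • c`, as a
polynomial in `s` with coefficients in `K[t]`. -/
def restrictPlane (K : Type*) [Field K] [Algebra K A] [FiniteDimensional K A] (a b c : A) :
    PolyRing K A →ₐ[K] K[X][X] :=
  MvPolynomial.aeval fun i =>
    C (C (coords K a i) * X + C (coords K b i)) + C (C (coords K c i)) * X

theorem eval_eval_restrictPlane (a b c : A) (p : PolyRing K A) (s t : K) :
    ((restrictPlane K a b c p).eval (C s)).eval t =
      MvPolynomial.eval (coords K (t • a + b + s • c)) p := by
  let ev : K[X][X] →ₐ[K] K := (aeval t).comp ((aeval (C s)).restrictScalars K)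
  have hcoords : (fun i => ev (C (C (coords K a i) * X + C (coords K b i)) +
      C (C (coords K c i)) * X)) = coords K (t • a + b + s • c) := by
    funext i
    simp only [ev, AlgHom.comp_apply, AlgHom.restrictScalars_apply, coe_aeval_eq_eval, eval_mul,
      eval_C, eval_X, coords_eq_equivFun, map_add, map_smul, Pi.add_apply, Pi.smul_apply,
      smul_eq_mul, mul_comm]
  rw [← hcoords]
  exact MvPolynomial.comp_aeval_apply _ ev p

end Plane

section MatrixAlgebra

variable {K : Type*} [Field K] {A : Type*} [Ring A] [Algebra K A] [FiniteDimensional K A]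

theorem IsRegular.companion_smul {k : ℕ} (hk : 0 < k) {w : A} (hw : IsRegular K (companion k w))
    {s : K} (hs : s ≠ 0) : IsRegular K (companion k (s • w)) := by
  rw [IsRegular, natDegree_minpoly_companion hk, minpoly_smul (IsIntegral.of_finite K w) hs,
    natDegree_scaleRoots, ← natDegree_minpoly_companion hk, hw]

theorem irreducible_normPoly_matrix [Infinite K] [IsDomain A] {k : ℕ} (hk : 0 < k) {w : A}
    (hw0 : w ≠ 0) (hw : IsRegular K (companion k w)) :
    Irreducible (normPoly K (Matrix (Fin k) (Fin k) A)) := by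
  have hint : IsIntegral K w := IsIntegral.of_finite K w
  have hcoeff : (minpoly K w).coeff 0 ≠ 0 := minpoly.coeff_zero_ne_zero hint hw0
  let f := restrictPlane K 1 (-companion k (0 : A)) (companion k 0 - companion k w)
  have hplane (s t : K) : t • 1 + -companion k (0 : A) + s • (companion k 0 - companion k w) =
      algebraMap K _ t - companion k (s • w) := by
    rw [companion_smul, Algebra.algebraMap_eq_smul_one, ← neg_sub (companion k w), smul_neg]
    abel
  have hnorm (s : K) (hs : s ≠ 0) (t : K) : ((f (normPoly K _)).eval (C s)).eval t =
      (minpoly K (companion k (s • w))).eval t := by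
    rw [eval_eval_restrictPlane, hplane, ← reducedNorm_eq_eval,
      (hw.companion_smul hk hs).reducedNorm_algebraMap_sub]
  have hf : f (normPoly K _) = ((minpoly K w).reverse.map C).scaleRoots (X ^ k) := by
    refine eq_of_eval_C_eval_eq fun s hs t => ?_
    rw [hnorm s hs, minpoly_companion hk, minpoly_smul hint hs, expand_eval,
      eval_eval_scaleRoots_map_C, eval_pow, eval_X, eval_scaleRoots_reverse hcoeff]
  have hone : (f (normPoly K _)).eval 1 = minpoly K (companion k w) := by
    refine Polynomial.funext fun t => ?_
    rw [← C_1, hnorm 1 one_ne_zero, one_smul]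
  refine irreducible_of_irreducible_map_of_totalDegree_le f
    ((aeval (1 : K[X])).restrictScalars K) (fun i => ?_) ?_ ?_
  · rw [AlgHom.restrictScalars_apply, coe_aeval_eq_eval]
    simp only [f, restrictPlane, MvPolynomial.aeval_X, eval_add, eval_mul, eval_C, eval_X, mul_one]
    compute_degree
  · rw [AlgHom.restrictScalars_apply, coe_aeval_eq_eval, hone, hw]
    exact (isHomogeneous_normPoly K _).totalDegree_le
  · rw [hf]
    exact irreducible_scaleRoots_map_C (irreducible_reverse (minpoly.irreducible hint) hcoeff) k

theorem exists_isRegular_ne_zero (K A : Type*) [Field K] [Infinite K] [Ring A] [Nontrivial A]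
    [Algebra K A] [FiniteDimensional K A] : ∃ b : A, b ≠ 0 ∧ IsRegular K b := by
  obtain ⟨b, hb⟩ := exists_isRegular K A
  by_cases hb0 : b = 0
  · refine ⟨b - algebraMap K A 1, ?_, hb.sub_algebraMap 1⟩
    rw [hb0, map_one, zero_sub]
    exact neg_ne_zero.2 one_ne_zero
  · exact ⟨b, hb0, hb⟩

end MatrixAlgebra

theorem IsRegular.companion (K C : Type*) {D : Type*} [Field K] [Infinite K] [Field C]
    [DivisionRing D] [Algebra K C] [Algebra C D] [Algebra K D] [IsScalarTower K C D]
    [FiniteDimensional K C] [FiniteDimensional C D] [FiniteDimensional K D] [Algebra.IsCentral C D]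
    {k : ℕ} (hk : 0 < k) {w : D} (hw : IsRegular K w) : IsRegular K (companion k w) := by
  rw [IsRegular, natDegree_minpoly_companion hk, hw, reducedDegree_divisionRing K C D,
    reducedDegree_matrix_divisionRing K C D hk]

theorem irreducible_normPoly_matrix_divisionRing (K C D : Type*) [Field K] [Infinite K] [Field C]
    [DivisionRing D] [Algebra K C] [Algebra C D] [Algebra K D] [IsScalarTower K C D]
    [FiniteDimensional K C] [FiniteDimensional C D] [FiniteDimensional K D] [Algebra.IsCentral C D]
    {k : ℕ} (hk : 0 < k) : Irreducible (normPoly K (Matrix (Fin k) (Fin k) D)) := by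
  obtain ⟨w, hw0, hw⟩ := exists_isRegular_ne_zero K D
  exact irreducible_normPoly_matrix hk hw0 (hw.companion K C hk)

end ReducedNorm

end

theorem theorem6p2p1 {K C D : Type*} [Field K] [Infinite K] [DivisionRing D] [Algebra K D]
    [FiniteDimensional K D]
    -- `C` is the center of `D`, as an extension field of `K`
    [Field C] [Algebra K C] [Algebra C D] [IsScalarTower K C D] [Algebra.IsCentral C D]
    -- these two finiteness properties follow from that of `D` over `K`
    [FiniteDimensional K C] [FiniteDimensional C D]
    (d c k : ℕ) (hd : ReducedNorm.reducedDegree C D = d) (hc : ReducedNorm.reducedDegree K C = c)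
    (hk : 1 ≤ k) :
    ReducedNorm.reducedDegree K (Matrix (Fin k) (Fin k) D) = d * k * c ∧
      ∀ χ : Matrix (Fin k) (Fin k) D → K, ReducedNorm.IsCharacter χ →
        ∃ t : ℕ, ∀ a : Matrix (Fin k) (Fin k) D, χ a = ReducedNorm.reducedNorm K a ^ t := by
  refine ⟨?_, fun χ hχ => ?_⟩
  · rw [ReducedNorm.reducedDegree_matrix_divisionRing K C D hk, hd, hc]
    ring
  · exact ReducedNorm.exists_eq_reducedNorm_pow_of_isCharacter
      (ReducedNorm.irreducible_normPoly_matrix_divisionRing K C D hk) hχ
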